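/- Let $\gamma_\star>0$ and $\alpha\in[1/2,1]$, with $\gamma_\star<1$ if $\alpha=1/2$. For $\varepsilon\in(0,1)$ consider the three-state Wang--Landau dynamics $(X_n,\theta_n)_{n\ge 0}$ on $\{1,2,3\}$ defined as follows. Let $$\theta_\star(1)=\theta_\star(3)=\frac1{2+\varepsilon},\qquad \theta_\star(2)=\frac{\varepsilon}{2+\varepsilon},\qquad Q=\begin{pmatrix}2/3&1/3&0\\1/3&1/3&1/3\\0&1/3&2/3\end{pmatrix},$$ and for positive weights $\theta=(\theta(1),\theta(2),\theta(3))$ let $\pi_\theta(i)=\Big(\sum_{j=1}^3\frac{\theta_\star(j)}{\theta(j)}\Big)^{-1}\frac{\theta_\star(i)}{\theta(i)}$ and let $P_\theta$ be the Metropolis kernel with proposal $Q$ and target $\pi_\theta$, that is, $P_\theta(i,j)=Q(i,j)\big(1\wedge\pi_\theta(j)/\pi_\theta(i)\big)$ for $i\ne j$, with the diagonal entries such that the rows sum to $1$. The process starts from $X_0=1$ and $\theta_0=(1/3,1/3,1/3)$; given the past up to time $n$, $X_{n+1}$ is drawn from $P_{\theta_n}(X_n,\cdot)$, and then, with $\gamma_n=\gamma_\star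 n^{-\alpha}$, $$\theta_{n+1}(i)=\theta_n(i)\,\frac{1+\gamma_{n+1}\mathbf 1_{\{X_{n+1}=i\}}}{1+\gamma_{n+1}\theta_n(X_{n+1})},\qquad i=1,2,3.$$ Let $T_{1\to3}=\min\{n: X_n=3\}$ (with $T_{1\to 3}=\infty$ if state $3$ is never visited). Then $$\lim_{\varepsilon\to0^+}\mathbb P\big(T_{1\to3}\in(a(\varepsilon),b(\varepsilon))\big)=1$$ in each of the following cases. 1. If $\alpha\in[1/2,1)$: $$a(\varepsilon)=\Big(\frac{1-\alpha}{\gamma_\star}\big[|\ln\varepsilon|-\beta(\varepsilon)\big]\Big)^{1/(1-\alpha)},\qquad b(\varepsilon)=C_b|\ln\varepsilon|^{1/(1-\alpha)},$$ where $C_b$ is any constant with $C_b>\big(\frac{1-\alpha}{\gamma_\star}\big)^{1/(1-\alpha)}$ and $\beta$ is any function with $0\le\beta(\varepsilon)\le|\ln\varepsilon|$ for all $\varepsilon\in(0,1)$ and $\lim_{\varepsilon\to0^+}|\ln\varepsilon|^{\alpha/(1-\alpha)}e^{-\beta(\varepsilon)}=0$. 2. If $\alpha=1$: $$a(\varepsilon)=\varepsilon^{-1/(1+\gamma_\star)}f(\varepsilon),\qquad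 b(\varepsilon)=\varepsilon^{-1/(1+\gamma_\star)}g(\varepsilon),$$ where $f,g$ are any positive functions on $(0,1)$ with $\lim_{\varepsilon\to0^+}f(\varepsilon)=0$ and $\lim_{\varepsilon\to0^+}g(\varepsilon)=\infty$. -/

import Mathlib

open Filter Topology MeasureTheory ProbabilityTheory

namespace WangLandau

noncomputable section

/-! The three strata `1, 2, 3` are the elements `0, 1, 2` of `Fin 3`. -/

/-- The nearest-neighbour symmetric proposal kernel. -/
def proposal : Matrix (Fin 3) (Fin 3) ℝ :=
  !![2/3, 1/3, 0;
     1/3, 1/3, 1/3;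
     0, 1/3, 2/3]

/-- The target probabilities `1/(2+ε)`, `ε/(2+ε)`, `1/(2+ε)` of the three strata. -/
def thetaStar (ε : ℝ) : Fin 3 → ℝ :=
  ![1 / (2 + ε), ε / (2 + ε), 1 / (2 + ε)]

/-- The biased probability measure associated with the weights `θ`. -/
def biased (ε : ℝ) (θ : Fin 3 → ℝ) (i : Fin 3) : ℝ :=
  (∑ j, thetaStar ε j / θ j)⁻¹ * (thetaStar ε i / θ i)

/-- The Metropolis acceptance probability `1 ∧ π(j)/π(i)`. The outer `max 0` changes nothing when
`π` is positive; it only makes the kernel below stochastic for all values of its arguments. -/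
def accept (π : Fin 3 → ℝ) (i j : Fin 3) : ℝ :=
  max 0 (min 1 (π j / π i))

/-- The Metropolis transition matrix with proposal `proposal` and target `π`: the off-diagonal
entries are proposal times acceptance, and the rows sum to one. -/
def metropolis (π : Fin 3 → ℝ) (i j : Fin 3) : ℝ :=
  if i = j then 1 - ∑ k ∈ Finset.univ.erase i, proposal i k * accept π i k
  else proposal i j * accept π i j

lemma accept_nonneg (π : Fin 3 → ℝ) (i j : Fin 3) : 0 ≤ accept π i j := le_max_left _ _

lemma accept_le_one (π : Fin 3 → ℝ) (i j : Fin 3) : accept π i j ≤ 1 :=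
  max_le zero_le_one (min_le_left _ _)

lemma proposal_nonneg (i j : Fin 3) : 0 ≤ proposal i j := by
  fin_cases i <;> fin_cases j <;> norm_num [proposal]

lemma proposal_sum (i : Fin 3) : ∑ j, proposal i j = 1 := by
  fin_cases i <;> simp [proposal, Fin.sum_univ_three] <;> norm_num

lemma metropolis_nonneg (π : Fin 3 → ℝ) (i j : Fin 3) : 0 ≤ metropolis π i j := by
  unfold metropolis
  split_ifs with h
  · have h1 : ∑ k ∈ Finset.univ.erase i, proposal i k * accept π i k
        ≤ ∑ k ∈ Finset.univ.erase i, proposal i k :=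
      Finset.sum_le_sum fun k _ =>
        mul_le_of_le_one_right (proposal_nonneg i k) (accept_le_one π i k)
    have h2 := Finset.add_sum_erase Finset.univ (proposal i) (Finset.mem_univ i)
    have h3 := proposal_sum i
    have h4 := proposal_nonneg i i
    linarith
  · exact mul_nonneg (proposal_nonneg i j) (accept_nonneg π i j)

lemma metropolis_sum (π : Fin 3 → ℝ) (i : Fin 3) : ∑ j, metropolis π i j = 1 := by
  rw [← Finset.add_sum_erase Finset.univ (metropolis π i) (Finset.mem_univ i)]
  have h : ∑ j ∈ Finset.univ.erase i, metropolis π i j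
      = ∑ k ∈ Finset.univ.erase i, proposal i k * accept π i k :=
    Finset.sum_congr rfl fun k hk => by
      simp [metropolis, (Finset.ne_of_mem_erase hk).symm]
  rw [h]
  simp [metropolis]

/-- The law `P_θ(i, ·)` of the next stratum, given the current stratum `i` and the weights `θ`:
one Metropolis step with target `biased ε θ`. -/
def transition (ε : ℝ) (θ : Fin 3 → ℝ) (i : Fin 3) : PMF (Fin 3) :=
  PMF.ofFintype (fun j => ENNReal.ofReal (metropolis (biased ε θ) i j)) (by
    rw [← ENNReal.ofReal_sum_of_nonneg fun j _ => metropolis_nonneg _ i j, metropolis_sum,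
      ENNReal.ofReal_one])

/-- The step sizes `γ⋆ n ^ (-α)`. -/
def stepSize (γ α : ℝ) (n : ℕ) : ℝ := γ * (n : ℝ) ^ (-α)

/-- The Wang-Landau weights `θ_n` along a trajectory `x` of strata, started from equal weights.
Only `x 1, …, x n` enter `θ_n`. -/
def weights (γ α : ℝ) (x : ℕ → Fin 3) : ℕ → Fin 3 → ℝ
  | 0 => fun _ => 1 / 3
  | n + 1 => fun i =>
      weights γ α x n i * (1 + stepSize γ α (n + 1) * (if x (n + 1) = i then 1 else 0)) /
        (1 + stepSize γ α (n + 1) * weights γ α x n (x (n + 1)))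

/-- A history `x 0, …, x n`, prolonged by an irrelevant constant to an infinite sequence. -/
def prolong (n : ℕ) (h : Finset.Iic n → Fin 3) (k : ℕ) : Fin 3 :=
  if hk : k ∈ Finset.Iic n then h ⟨k, hk⟩ else 0

/-- The conditional law of `X_{n+1}` given `X_0, …, X_n`: it is `P_{θ_n}(X_n, ·)`, where `θ_n` is
the function `weights` of `X_0, …, X_n`. -/
def stepKernel (ε γ α : ℝ) (n : ℕ) : Kernel (Finset.Iic n → Fin 3) (Fin 3) where
  toFun h := (transition ε (weights γ α (prolong n h) n) (prolong n h n)).toMeasure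
  measurable' := measurable_of_countable _

instance stepKernel_isMarkov (ε γ α : ℝ) (n : ℕ) : IsMarkovKernel (stepKernel ε γ α n) :=
  ⟨fun _ => PMF.toMeasure.isProbabilityMeasure _⟩

/-- The law, on the space of trajectories, of the sequence of strata `(X_n)` of the Wang-Landau
dynamics started from the first stratum, given by the Ionescu-Tulcea theorem. -/
def law (ε γ α : ℝ) : Measure (ℕ → Fin 3) :=
  Kernel.traj (X := fun _ => Fin 3) (stepKernel ε γ α) 0 (fun _ => 0)

/-- The first time at which the trajectory is in the third stratum (`⊤` if there is none). -/
def exitTime (x : ℕ → Fin 3) : ℕ∞ := ⨅ (n : ℕ) (_ : x n = 2), (n : ℕ∞)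

/-- The probability that `T_{1→3}` belongs to the open interval `(a, b)`. -/
def exitProb (ε γ α a b : ℝ) : ℝ :=
  (law ε γ α).real {x | ∃ n : ℕ, exitTime x = n ∧ a < n ∧ n < b}

end

end WangLandau

namespace WangLandau

/-! ### One-step estimates for the law of the trajectory -/

/-! In the code's numbering the strata are `0`, `1`, `2`. Only ratios of weights enter the
acceptance probabilities, so the normalised weights may be replaced by the products `occupation`,
written `u₀, u₁, u₂`. A move `0 → 1` then has probability `(1/3) min(1, ε u₀/u₁)`. Before the exit
`u₂ = 1`, a move `1 → 2` has probability exactly `1/3`, and `u₀ u₁ = growth n`, because every step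
multiplies exactly one of `u₀`, `u₁`.

Lower bound: while the walk has never left `0`, `u₁ = 1` and `u₀ = growth n`, so it leaves at the
next step with probability at most `ε * growth n`. A union bound and a telescoping sum
(`law_leave_le`, `growth_sum_le`) bound the probability of having left by time `n` by `ε n^α growth
n / γ`.

Upper bound: fix `K`. With at most `K` visits of `1`, `u₁ ≤ (1+γ)^K`, hence `u₀/u₁ ≥ growth m /
(1+γ)^(2K)` from time `m` on. Each step then either visits `1` or exits with probability bounded
below, so having few visits for a long time without exit is exponentially unlikely. Having `K`
visits that are not followed by an exit costs `(2/3)^K`. Two supermartingale-type functionals,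
`discount` and `reward`, make this precise without stopping times (`law_stay_le`).

The two bounds combine in `one_sub_exitProb_le`. Since `K` is fixed before `ε → 0`, it costs only a
constant factor, which the slack in `b(ε)` absorbs. What remains is deterministic: `growth n` is
about `exp(γ n^(1-α)/(1-α))` for `α < 1`, up to a factor `r < 1` in the exponent, and of order `n^γ`
for `α = 1`. -/

lemma dependsOn_prolong_frestrictLe {β : Type*} {n : ℕ} {G : (ℕ → Fin 3) → β}
    (hG : DependsOn G (Set.Iic n)) (x : ℕ → Fin 3) :
    G (prolong n (Preorder.frestrictLe n x)) = G x := by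
  refine hG fun k hk => ?_
  have hk' : k ≤ n := hk
  simp [prolong, hk']

/-- A function of finitely many coordinates factors through a countable discrete space, on which
every function is measurable. -/
lemma measurable_of_dependsOn {β : Type*} [MeasurableSpace β] {n : ℕ} {G : (ℕ → Fin 3) → β}
    (hG : DependsOn G (Set.Iic n)) : Measurable G := by
  have h : G = (fun h => G (prolong n h)) ∘ Preorder.frestrictLe n :=
    funext fun x => (dependsOn_prolong_frestrictLe hG x).symm
  rw [h]
  exact (measurable_of_countable _).comp (by fun_prop)

/-- If `∑ j, P(x, j) F(x₀, …, xₙ, j) ≤ G(x₀, …, xₙ)`, then the expectation of `F` is at most that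
of `G`. -/
lemma lintegral_law_le_of_step {ε γ α : ℝ} {n : ℕ} {F G : (ℕ → Fin 3) → ℝ}
    (hF : DependsOn F (Set.Iic (n + 1))) (hG : DependsOn G (Set.Iic n)) (hF0 : ∀ x, 0 ≤ F x)
    (h : ∀ x, ∑ j, metropolis (biased ε (weights γ α x n)) (x n) j
      * F (Function.update x (n + 1) j) ≤ G x) :
    ∫⁻ x, ENNReal.ofReal (F x) ∂law ε γ α ≤ ∫⁻ x, ENNReal.ofReal (G x) ∂law ε γ α := by
  -- `F` read as a function of the history up to `n` and the next state, whose joint law is a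
  -- composition-product with the step kernel.
  let ψ : (Finset.Iic n → Fin 3) × Fin 3 → ℝ :=
    fun q => F (Function.update (prolong n q.1) (n + 1) q.2)
  have hFψ : ∀ x : ℕ → Fin 3, F x = ψ (Preorder.frestrictLe n x, x (n + 1)) := by
    intro x
    refine hF fun k hk => ?_
    rcases Nat.lt_or_ge n k with hnk | hkn
    · have : k = n + 1 := le_antisymm hk hnk
      subst this
      simp
    · rw [Function.update_of_ne (by lia)]
      simp [prolong, hkn]
  have hmeas : Measurable fun q => ENNReal.ofReal (ψ q) := measurable_of_countable _
  let x₀ : Finset.Iic 0 → Fin 3 := fun _ => 0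
  calc ∫⁻ x, ENNReal.ofReal (F x) ∂law ε γ α
      = ∫⁻ x, ENNReal.ofReal (ψ (Preorder.frestrictLe n x, x (n + 1))) ∂law ε γ α := by
        simp_rw [hFψ]
    _ = ∫⁻ q, ENNReal.ofReal (ψ q) ∂((law ε γ α).map
          fun x => (Preorder.frestrictLe n x, x (n + 1))) := by
        rw [lintegral_map hmeas (by fun_prop)]
    _ = ∫⁻ q, ENNReal.ofReal (ψ q) ∂(Measure.compProd
          (Kernel.partialTraj (X := fun _ => Fin 3) (stepKernel ε γ α) 0 n x₀)
          (stepKernel ε γ α n)) := by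
        rw [Kernel.partialTraj_compProd_eq_map_traj (Nat.zero_le n)]
        rfl
    _ = ∫⁻ h, ∫⁻ j, ENNReal.ofReal (ψ (h, j)) ∂(stepKernel ε γ α n h)
          ∂(Kernel.partialTraj (X := fun _ => Fin 3) (stepKernel ε γ α) 0 n x₀) := by
        rw [Measure.lintegral_compProd hmeas]
    _ ≤ ∫⁻ h, ENNReal.ofReal (G (prolong n h))
          ∂(Kernel.partialTraj (X := fun _ => Fin 3) (stepKernel ε γ α) 0 n x₀) := by
        refine lintegral_mono fun h' => ?_
        change ∫⁻ j, ENNReal.ofReal (ψ (h', j))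
          ∂(transition ε (weights γ α (prolong n h') n) (prolong n h' n)).toMeasure ≤ _
        rw [lintegral_fintype]
        refine le_trans (le_of_eq ?_) (ENNReal.ofReal_le_ofReal (h (prolong n h')))
        rw [ENNReal.ofReal_sum_of_nonneg
          fun j _ => mul_nonneg (metropolis_nonneg _ _ _) (hF0 _)]
        refine Finset.sum_congr rfl fun j _ => ?_
        rw [PMF.toMeasure_apply_singleton _ _ (MeasurableSet.singleton _),
          ENNReal.ofReal_mul (metropolis_nonneg _ _ _), mul_comm]
        rfl
    _ = ∫⁻ x, ENNReal.ofReal (G x) ∂law ε γ α := by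
        rw [← Kernel.traj_map_frestrictLe_apply, lintegral_map (measurable_of_countable _)
          (by fun_prop)]
        exact lintegral_congr fun x => by rw [dependsOn_prolong_frestrictLe hG x]

instance (ε γ α : ℝ) : IsProbabilityMeasure (law ε γ α) := by
  unfold law; infer_instance

lemma ae_law_zero (ε γ α : ℝ) : ∀ᵐ x ∂law ε γ α, x 0 = 0 := by
  have h := Kernel.traj_map_frestrictLe_apply (X := fun _ => Fin 3) (κ := stepKernel ε γ α) 0 0
    (fun _ => 0)
  have h1 : ∀ᵐ y ∂((law ε γ α).map (Preorder.frestrictLe (π := fun _ => Fin 3) 0)),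
      y ⟨0, by simp⟩ = 0 := by
    unfold law
    rw [h, Kernel.partialTraj_self, Kernel.id_apply, ae_dirac_iff (Set.to_countable _).measurableSet]
  exact ae_of_ae_map (by fun_prop) h1

/-! ### The weights before the exit -/

/-- The unnormalised weights. -/
noncomputable def occupation (γ α : ℝ) (x : ℕ → Fin 3) (n : ℕ) (i : Fin 3) : ℝ :=
  ∏ k ∈ Finset.Icc 1 n, (1 + stepSize γ α k * (if x k = i then 1 else 0))

/-- The unnormalised weight of a stratum that is never left. -/
noncomputable def growth (γ α : ℝ) (n : ℕ) : ℝ := ∏ k ∈ Finset.Icc 1 n, (1 + stepSize γ α k)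

/-- The number of visits of the second stratum before time `n`. -/
def visits (x : ℕ → Fin 3) (n : ℕ) : ℕ := ((Finset.range n).filter fun k => x k = 1).card

lemma stepSize_nonneg {γ : ℝ} (hγ : 0 < γ) (α : ℝ) (n : ℕ) : 0 ≤ stepSize γ α n := by
  unfold stepSize; positivity

lemma stepSize_le {γ α : ℝ} (hγ : 0 < γ) (hα : 0 ≤ α) {n : ℕ} (hn : 1 ≤ n) :
    stepSize γ α n ≤ γ := by
  unfold stepSize
  have h : (n : ℝ) ^ (-α) ≤ 1 :=
    Real.rpow_le_one_of_one_le_of_nonpos (by exact_mod_cast hn) (by linarith)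
  nlinarith

lemma growth_succ (γ α : ℝ) (n : ℕ) :
    growth γ α (n + 1) = growth γ α n * (1 + stepSize γ α (n + 1)) := by
  unfold growth
  rw [Finset.prod_Icc_succ_top (by lia)]

lemma growth_zero (γ α : ℝ) : growth γ α 0 = 1 := by simp [growth]

lemma growth_mono {γ : ℝ} (hγ : 0 < γ) (α : ℝ) : Monotone (growth γ α) := by
  refine monotone_nat_of_le_succ fun n => ?_
  rw [growth_succ]
  have h := stepSize_nonneg hγ α (n + 1)
  have h0 : 0 ≤ growth γ α n :=
    Finset.prod_nonneg fun k _ => by have := stepSize_nonneg hγ α k; linarith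
  nlinarith

lemma one_le_growth {γ : ℝ} (hγ : 0 < γ) (α : ℝ) (n : ℕ) : 1 ≤ growth γ α n := by
  simpa [growth_zero] using growth_mono hγ α (Nat.zero_le n)

lemma one_le_occupation {γ : ℝ} (hγ : 0 < γ) (α : ℝ) (x : ℕ → Fin 3) (n : ℕ) (i : Fin 3) :
    1 ≤ occupation γ α x n i := by
  unfold occupation
  refine Finset.prod_induction _ (fun r => 1 ≤ r) (fun a b => one_le_mul_of_one_le_of_one_le)
    le_rfl fun k _ => ?_
  have := stepSize_nonneg hγ α k
  split_ifs <;> linarith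

lemma occupation_succ (γ α : ℝ) (x : ℕ → Fin 3) (n : ℕ) (i : Fin 3) :
    occupation γ α x (n + 1) i = occupation γ α x n i *
      (1 + stepSize γ α (n + 1) * (if x (n + 1) = i then 1 else 0)) := by
  unfold occupation
  rw [Finset.prod_Icc_succ_top (by lia)]

/-- The denominator of the update is common to all strata, so it only changes the constant `c`,
which cancels in acceptance ratios. -/
lemma exists_weights_eq {γ : ℝ} (hγ : 0 < γ) (α : ℝ) (x : ℕ → Fin 3) (n : ℕ) :
    ∃ c : ℝ, 0 < c ∧ ∀ i, weights γ α x n i = c * occupation γ α x n i := by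
  induction n with
  | zero => exact ⟨1 / 3, by norm_num, fun i => by simp [weights, occupation]⟩
  | succ n ih =>
    obtain ⟨c, hc, h⟩ := ih
    have h1 := stepSize_nonneg hγ α (n + 1)
    have h2 : 0 ≤ weights γ α x n (x (n + 1)) := by
      rw [h]; have := one_le_occupation hγ α x n (x (n + 1)); positivity
    refine ⟨c / (1 + stepSize γ α (n + 1) * weights γ α x n (x (n + 1))), by positivity,
      fun i => ?_⟩
    rw [occupation_succ]
    simp only [weights]
    rw [h i]
    ring

lemma occupation_two {γ α : ℝ} {x : ℕ → Fin 3} {n : ℕ} (hx : ∀ k ≤ n, x k ≠ 2) :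
    occupation γ α x n 2 = 1 := by
  unfold occupation
  refine Finset.prod_eq_one fun k hk => ?_
  simp [hx k (Finset.mem_Icc.1 hk).2]

/-- Before the exit, each step puts its factor `1 + stepSize` on exactly one of the strata `0` and
`1`. -/
lemma occupation_zero_mul_one {γ α : ℝ} {x : ℕ → Fin 3} {n : ℕ} (hx : ∀ k ≤ n, x k ≠ 2) :
    occupation γ α x n 0 * occupation γ α x n 1 = growth γ α n := by
  unfold occupation growth
  rw [← Finset.prod_mul_distrib]
  refine Finset.prod_congr rfl fun k hk => ?_
  have h2 := hx k (Finset.mem_Icc.1 hk).2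
  generalize x k = y at h2
  fin_cases y <;> simp_all

lemma visits_succ (x : ℕ → Fin 3) (n : ℕ) :
    visits x (n + 1) = visits x n + if x n = 1 then 1 else 0 := by
  unfold visits
  rw [Finset.range_add_one, Finset.filter_insert]
  split_ifs <;> simp

/-- Each visit multiplies the weight by at most `1 + γ`. The index `n + 1` makes `visits` count the
current time `n`. -/
lemma occupation_one_le {γ α : ℝ} (hγ : 0 < γ) (hα : 0 ≤ α) (x : ℕ → Fin 3) (n : ℕ) :
    occupation γ α x n 1 ≤ (1 + γ) ^ visits x (n + 1) := by
  induction n with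
  | zero => simpa [occupation] using one_le_pow₀ (by linarith : 1 ≤ 1 + γ)
  | succ n ih =>
    rw [occupation_succ, visits_succ x (n + 1), pow_add]
    have h1 := stepSize_nonneg hγ α (n + 1)
    have h2 := stepSize_le hγ hα (Nat.le_add_left 1 n)
    refine mul_le_mul ih ?_ (by positivity) (by positivity)
    split_ifs <;> simp [h2]

/-! ### Transition probabilities in terms of the unnormalised weights. -/

lemma accept_biased {ε γ α : ℝ} (hε : 0 < ε) (hγ : 0 < γ) (x : ℕ → Fin 3) (n : ℕ) (i j : Fin 3) :
    accept (biased ε (weights γ α x n)) i j =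
      min 1 (thetaStar ε j * occupation γ α x n i / (thetaStar ε i * occupation γ α x n j)) := by
  obtain ⟨c, hc, h⟩ := exists_weights_eq hγ α x n
  have hp : ∀ k, 0 < thetaStar ε k := by
    intro k; fin_cases k <;> simp [thetaStar] <;> positivity
  have ho : ∀ k, 0 < occupation γ α x n k := fun k =>
    one_pos.trans_le (one_le_occupation hγ α x n k)
  have hs : 0 < ∑ k, thetaStar ε k / weights γ α x n k :=
    Finset.sum_pos (fun k _ => by rw [h]; have := hp k; have := ho k; positivity) (by simp)
  have hpi := hp i
  have hpj := hp j
  have hoi := ho i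
  have hoj := ho j
  have key : biased ε (weights γ α x n) j / biased ε (weights γ α x n) i =
      thetaStar ε j * occupation γ α x n i / (thetaStar ε i * occupation γ α x n j) := by
    unfold biased
    rw [mul_div_mul_left _ _ (inv_ne_zero hs.ne'), h i, h j]
    field_simp
  unfold accept
  rw [key]
  exact max_eq_right (le_min zero_le_one (by positivity))

lemma metropolis_zero_one {ε γ α : ℝ} (hε : 0 < ε) (hγ : 0 < γ) (x : ℕ → Fin 3) (n : ℕ) :
    metropolis (biased ε (weights γ α x n)) 0 1 =
      1 / 3 * min 1 (ε * occupation γ α x n 0 / occupation γ α x n 1) := by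
  have h : thetaStar ε 1 * occupation γ α x n 0 / (thetaStar ε 0 * occupation γ α x n 1) =
      ε * occupation γ α x n 0 / occupation γ α x n 1 := by
    simp only [thetaStar, Matrix.cons_val_zero, Matrix.cons_val_one]
    field_simp
  rw [metropolis, if_neg (by decide), accept_biased hε hγ, h]
  simp [proposal]

lemma metropolis_zero_two (π : Fin 3 → ℝ) : metropolis π 0 2 = 0 := by
  rw [metropolis, if_neg (by decide)]
  simp [proposal]

/-- The acceptance ratio is `u₁ / ε ≥ 1`, so the proposed move to the unvisited stratum is always
accepted. -/
lemma metropolis_one_two {ε γ α : ℝ} (hε : 0 < ε) (hε1 : ε ≤ 1) (hγ : 0 < γ) {x : ℕ → Fin 3}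
    {n : ℕ} (hx : ∀ k ≤ n, x k ≠ 2) :
    metropolis (biased ε (weights γ α x n)) 1 2 = 1 / 3 := by
  have h : 1 ≤ thetaStar ε 2 * occupation γ α x n 1 / (thetaStar ε 1 * occupation γ α x n 2) := by
    have h1 := one_le_occupation hγ α x n 1
    rw [occupation_two hx]
    simp only [thetaStar, Matrix.cons_val_one, Matrix.cons_val]
    rw [le_div_iff₀ (by positivity)]
    have : ε / (2 + ε) ≤ 1 / (2 + ε) := by gcongr
    have : 0 < 1 / (2 + ε) := by positivity
    nlinarith
  rw [metropolis, if_neg (by decide), accept_biased hε hγ, min_eq_left h]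
  simp [proposal]

/-- Write `u₀ / u₁ = u₀ u₁ / u₁²`, where `u₀ u₁ = growth n ≥ growth m` and `u₁ ≤ (1 + γ) ^ K`. -/
lemma metropolis_zero_one_ge {ε γ α : ℝ} (hε : 0 < ε) (hγ : 0 < γ) (hα : 0 ≤ α) {x : ℕ → Fin 3}
    {m n K : ℕ} (hmn : m ≤ n) (hx : ∀ k ≤ n, x k ≠ 2) (hK : visits x (n + 1) ≤ K) :
    1 / 3 * min 1 (ε * growth γ α m / ((1 + γ) ^ K) ^ 2) ≤
      metropolis (biased ε (weights γ α x n)) 0 1 := by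
  rw [metropolis_zero_one hε hγ]
  have h0 := one_le_occupation hγ α x n 0
  have h1 := one_le_occupation hγ α x n 1
  have h2 : occupation γ α x n 1 ≤ (1 + γ) ^ K :=
    (occupation_one_le hγ hα x n).trans (pow_le_pow_right₀ (by linarith) hK)
  have h3 : growth γ α m ≤ occupation γ α x n 0 * occupation γ α x n 1 := by
    rw [occupation_zero_mul_one hx]; exact growth_mono hγ α hmn
  have h4 : occupation γ α x n 1 ^ 2 ≤ ((1 + γ) ^ K) ^ 2 := by gcongr
  have h5 : ε * growth γ α m / ((1 + γ) ^ K) ^ 2 ≤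
      ε * occupation γ α x n 0 / occupation γ α x n 1 := by
    rw [div_le_div_iff₀ (by positivity) (by positivity)]
    calc ε * growth γ α m * occupation γ α x n 1
        ≤ ε * (occupation γ α x n 0 * occupation γ α x n 1) * occupation γ α x n 1 := by gcongr
      _ = ε * occupation γ α x n 0 * occupation γ α x n 1 ^ 2 := by ring
      _ ≤ _ := by gcongr
  gcongr

/-! ### Lower bound on the exit time -/

/-- Step sizes decrease, so `stepSize n * growth k ≤ growth (k + 1) - growth k` for `k < n`, and the
right side telescopes. -/
lemma growth_sum_le {γ α : ℝ} (hγ : 0 < γ) (hα : 0 ≤ α) (n : ℕ) :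
    ∑ k ∈ Finset.range n, growth γ α k ≤ (n : ℝ) ^ α * growth γ α n / γ := by
  rcases Nat.eq_zero_or_pos n with rfl | hn
  · have := one_le_growth hγ α 0
    simp only [Finset.range_zero, Finset.sum_empty]
    positivity
  have hn' : (0 : ℝ) < n := by exact_mod_cast hn
  have hs : stepSize γ α n = γ / (n : ℝ) ^ α := by
    rw [stepSize, Real.rpow_neg hn'.le]; rfl
  have hpos : 0 < stepSize γ α n := by rw [hs]; positivity
  have h1 : ∀ k ∈ Finset.range n,
      stepSize γ α n * growth γ α k ≤ growth γ α (k + 1) - growth γ α k := by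
    intro k hk
    have hk' : k + 1 ≤ n := Finset.mem_range.1 hk
    have h2 : stepSize γ α n ≤ stepSize γ α (k + 1) := by
      unfold stepSize
      refine mul_le_mul_of_nonneg_left ?_ hγ.le
      exact Real.rpow_le_rpow_of_nonpos (by positivity) (by exact_mod_cast hk') (by linarith)
    have h3 := one_le_growth hγ α k
    rw [growth_succ]
    nlinarith
  have h2 := Finset.sum_le_sum h1
  rw [Finset.sum_range_sub, ← Finset.mul_sum, growth_zero] at h2
  have h3 : (n : ℝ) ^ α * growth γ α n / γ = growth γ α n / stepSize γ α n := by
    rw [hs]; field_simp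
  rw [h3, le_div_iff₀ hpos]
  linarith

lemma metropolis_zero_one_le {ε γ α : ℝ} (hε : 0 < ε) (hγ : 0 < γ) {x : ℕ → Fin 3} {n : ℕ}
    (hx : ∀ k ≤ n, x k = 0) :
    metropolis (biased ε (weights γ α x n)) 0 1 ≤ ε * growth γ α n := by
  rw [metropolis_zero_one hε hγ]
  have h1 : occupation γ α x n 1 = 1 := by
    unfold occupation
    refine Finset.prod_eq_one fun k hk => ?_
    simp [hx k (Finset.mem_Icc.1 hk).2]
  have h0 : occupation γ α x n 0 = growth γ α n := by
    rw [← occupation_zero_mul_one (x := x) (n := n) (fun k hk => by rw [hx k hk]; decide), h1, mul_one]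
  rw [h1, h0, div_one]
  have h2 := min_le_right 1 (ε * growth γ α n)
  have h3 := one_le_growth hγ α n
  have h4 : 0 < ε * growth γ α n := by positivity
  linarith

-- Union bound over the time of the first departure from `0`: each step adds at most `ε * growth k`
-- to the probability of having left.
open Classical in
lemma law_leave_le {ε γ α : ℝ} (hε : 0 < ε) (hγ : 0 < γ) (n : ℕ) :
    ∫⁻ x, ENNReal.ofReal (if ∀ k ≤ n, x k = 0 then 0 else 1) ∂law ε γ α ≤
      ENNReal.ofReal (ε * ∑ k ∈ Finset.range n, growth γ α k) := by
  induction n with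
  | zero =>
    refine le_of_eq_of_le (lintegral_congr_ae (g := fun _ => 0) ?_) (by simp)
    filter_upwards [ae_law_zero ε γ α] with x hx
    simp [hx]
  | succ n ih =>
    have hpos : ∀ k, 0 ≤ ε * growth γ α k := fun k => by
      have := one_le_growth hγ α k; positivity
    have hdep : ∀ m : ℕ, DependsOn (fun x : ℕ → Fin 3 => if ∀ k ≤ m, x k = 0 then (0 : ℝ) else 1)
        (Set.Iic m) := by
      intro m x y h
      have : (∀ k ≤ m, x k = 0) ↔ ∀ k ≤ m, y k = 0 :=
        forall₂_congr fun k hk => by rw [h k hk]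
      simp only [this]
    have hstep := lintegral_law_le_of_step (ε := ε) (γ := γ) (α := α) (hdep (n + 1))
      (G := fun x : ℕ → Fin 3 => (if ∀ k ≤ n, x k = 0 then (0 : ℝ) else 1) + ε * growth γ α n)
      (fun x y h => by simp only [hdep n h]) (fun x => by split_ifs <;> norm_num) (by
        intro x
        have hsum := metropolis_sum (biased ε (weights γ α x n)) (x n)
        by_cases hx : ∀ k ≤ n, x k = 0
        · have hn : x n = 0 := hx n le_rfl
          have hup : ∀ k ≤ n + 1, Function.update x (n + 1) 0 k = 0 := by
            intro k hk
            rcases Nat.lt_or_ge n k with h | h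
            · obtain rfl : k = n + 1 := by lia
              simp
            · rw [Function.update_of_ne (by lia), hx k h]
          have hup' : ∀ j : Fin 3, j ≠ 0 → ¬ ∀ k ≤ n + 1, Function.update x (n + 1) j k = 0 :=
            fun j hj h => hj (by simpa using h (n + 1) le_rfl)
          simp only [Fin.sum_univ_three, hn]
          rw [if_pos hup, if_neg (hup' 1 (by decide)), if_neg (hup' 2 (by decide)), if_pos hx,
            metropolis_zero_two]
          have := metropolis_zero_one_le (α := α) hε hγ hx
          linarith
        · rw [if_neg hx]
          refine le_trans ?_ (le_add_of_nonneg_right (hpos n))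
          refine le_trans (Finset.sum_le_sum fun j _ =>
            mul_le_of_le_one_right (metropolis_nonneg _ _ _) ?_) hsum.le
          split_ifs <;> norm_num)
    refine hstep.trans ?_
    have hadd : ∀ x : ℕ → Fin 3, ENNReal.ofReal
        ((if ∀ k ≤ n, x k = 0 then (0 : ℝ) else 1) + ε * growth γ α n) =
        ENNReal.ofReal (if ∀ k ≤ n, x k = 0 then (0 : ℝ) else 1) +
          ENNReal.ofReal (ε * growth γ α n) := fun x =>
      ENNReal.ofReal_add (by split_ifs <;> norm_num) (hpos n)
    simp_rw [hadd]
    rw [lintegral_add_right _ measurable_const, lintegral_const, measure_univ, mul_one,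
      Finset.sum_range_succ, mul_add, ENNReal.ofReal_add
        (mul_nonneg hε.le (Finset.sum_nonneg fun k _ => zero_le_one.trans (one_le_growth hγ α k)))
        (hpos n)]
    gcongr

/-! ### Upper bound on the exit time -/

open Classical in
/-- Discounts every visit of the second stratum by the factor `r`, as long as there has been no exit
and there have been at most `K` visits. -/
noncomputable def discount (K n : ℕ) (x : ℕ → Fin 3) : ℝ :=
  if (∀ k ≤ n, x k ≠ 2) ∧ visits x (n + 1) ≤ K then (1 / 2) ^ visits x (n + 1) else 0

open Classical in
/-- The reward `(3/2) ^ v`, where `v` is the number of visits of the second stratum that were not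
followed by an exit; it vanishes after the exit. -/
noncomputable def reward (n : ℕ) (x : ℕ → Fin 3) : ℝ :=
  if ∀ k ≤ n, x k ≠ 2 then (3 / 2) ^ visits x n else 0

lemma visits_congr {n : ℕ} {x y : ℕ → Fin 3} (h : ∀ k < n, x k = y k) : visits x n = visits y n := by
  unfold visits
  congr 1
  exact Finset.filter_congr fun k hk => by rw [h k (Finset.mem_range.1 hk)]

lemma forall_le_congr {n : ℕ} {x y : ℕ → Fin 3} (h : ∀ k ≤ n, x k = y k) :
    (∀ k ≤ n, x k ≠ 2) ↔ ∀ k ≤ n, y k ≠ 2 :=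
  forall₂_congr fun k hk => by rw [h k hk]

lemma dependsOn_discount (K n : ℕ) : DependsOn (discount K n) (Set.Iic n) := by
  intro x y h
  unfold discount
  simp only [forall_le_congr h, visits_congr (n := n + 1) fun k hk => h k (Nat.lt_succ_iff.1 hk)]

lemma dependsOn_reward (n : ℕ) : DependsOn (reward n) (Set.Iic n) := by
  intro x y h
  unfold reward
  simp only [forall_le_congr h, visits_congr (n := n) fun k hk => h k hk.le]

lemma discount_nonneg (K n : ℕ) (x : ℕ → Fin 3) : 0 ≤ discount K n x := by
  unfold discount; split_ifs <;> positivity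

lemma discount_le_one (K n : ℕ) (x : ℕ → Fin 3) : discount K n x ≤ 1 := by
  unfold discount
  split_ifs
  · exact pow_le_one₀ (by norm_num) (by norm_num)
  · norm_num

lemma reward_nonneg (n : ℕ) (x : ℕ → Fin 3) : 0 ≤ reward n x := by
  unfold reward; split_ifs <;> positivity

lemma forall_update_ne {n : ℕ} {x : ℕ → Fin 3} {j : Fin 3} :
    (∀ k ≤ n + 1, Function.update x (n + 1) j k ≠ 2) ↔ (∀ k ≤ n, x k ≠ 2) ∧ j ≠ 2 := by
  constructor
  · intro h
    refine ⟨fun k hk => ?_, by simpa using h (n + 1) le_rfl⟩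
    have := h k (by lia)
    rwa [Function.update_of_ne (by lia)] at this
  · rintro ⟨h, hj⟩ k hk
    rcases Nat.lt_or_ge n k with h' | h'
    · obtain rfl : k = n + 1 := by lia
      simpa using hj
    · rw [Function.update_of_ne (by lia)]; exact h k h'

lemma visits_update (n : ℕ) (x : ℕ → Fin 3) (j : Fin 3) :
    visits (Function.update x (n + 1) j) (n + 1) = visits x (n + 1) :=
  visits_congr fun k hk => Function.update_of_ne (by lia) _ _

lemma fin_three_ne_two {i : Fin 3} (h : i ≠ 2) : i = 0 ∨ i = 1 := by
  fin_cases i <;> simp_all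

/-- With `P₁`, `P₂` the probabilities of the next state, a visit halves the discount and an exit
kills it, so the mean factor is at most `1 - P₁/2 - P₂ ≤ 1 - (P₁ + P₂)/2`. -/
lemma discount_step {ε γ α : ℝ} (hε : 0 < ε) (hε1 : ε ≤ 1) (hγ : 0 < γ) (hα : 0 ≤ α)
    {K m n : ℕ} (hmn : m ≤ n) (x : ℕ → Fin 3) :
    ∑ j, metropolis (biased ε (weights γ α x n)) (x n) j
      * discount K (n + 1) (Function.update x (n + 1) j) ≤
      (1 - 1 / 6 * min 1 (ε * growth γ α m / ((1 + γ) ^ K) ^ 2)) * discount K n x := by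
  set p := min 1 (ε * growth γ α m / ((1 + γ) ^ K) ^ 2) with hp
  by_cases hx : (∀ k ≤ n, x k ≠ 2) ∧ visits x (n + 1) ≤ K
  · have hsum := metropolis_sum (biased ε (weights γ α x n)) (x n)
    have hnn := metropolis_nonneg (biased ε (weights γ α x n)) (x n)
    -- From `0` the move to `1` suffices; from `1` the exit alone has probability `1/3`, and `p ≤
    -- 1`.
    have hj : 1 / 3 * p ≤ metropolis (biased ε (weights γ α x n)) (x n) 1 +
        metropolis (biased ε (weights γ α x n)) (x n) 2 := by
      rcases fin_three_ne_two (hx.1 n le_rfl) with h | h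
      · have h1 := metropolis_zero_one_ge hε hγ hα hmn hx.1 hx.2
        have h2 := hnn 2
        rw [h] at h2 ⊢
        linarith
      · have h1 := metropolis_one_two (α := α) hε hε1 hγ hx.1
        have h2 := hnn 1
        have h3 : p ≤ 1 := min_le_left _ _
        rw [h] at h2 ⊢
        linarith
    have hd : discount K n x = (1 / 2) ^ visits x (n + 1) := if_pos hx
    have d0 : discount K (n + 1) (Function.update x (n + 1) 0) ≤ discount K n x := by
      rw [hd]
      unfold discount
      rw [visits_succ, visits_update]
      split_ifs <;> first | positivity | simp_all
    have d1 : discount K (n + 1) (Function.update x (n + 1) 1) ≤ 1 / 2 * discount K n x := by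
      rw [hd]
      unfold discount
      rw [visits_succ, visits_update]
      simp only [Function.update_self, if_true]
      split_ifs
      · rw [pow_succ]; linarith
      · positivity
    have d2 : discount K (n + 1) (Function.update x (n + 1) 2) = 0 := by
      unfold discount
      rw [if_neg]
      exact fun h => (forall_update_ne.1 h.1).2 rfl
    rw [Fin.sum_univ_three] at hsum ⊢
    rw [d2]
    have hd0 := discount_nonneg K n x
    have e0 := mul_le_mul_of_nonneg_left d0 (hnn 0)
    have e1 := mul_le_mul_of_nonneg_left d1 (hnn 1)
    have e2 := mul_nonneg (hnn 2) hd0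
    have e3 := mul_le_mul_of_nonneg_right hj hd0
    have e4 : metropolis (biased ε (weights γ α x n)) (x n) 0 = 1 -
      metropolis (biased ε (weights γ α x n)) (x n) 1 -
      metropolis (biased ε (weights γ α x n)) (x n) 2 := by linarith
    rw [e4] at e0 ⊢
    linarith
  · have hd : discount K n x = 0 := if_neg hx
    have hd' : ∀ j, discount K (n + 1) (Function.update x (n + 1) j) = 0 := by
      intro j
      refine if_neg fun h => hx ⟨(forall_update_ne.1 h.1).1, ?_⟩
      have := h.2
      rw [visits_succ, visits_update] at this
      lia
    simp [hd, hd']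

/-- From `1` the walk survives with probability `2/3`, which exactly offsets the gain `3/2`; from
`0` nothing is gained. Hence `reward` counts visits strictly before `n`: the current visit is
credited only once it has been survived. -/
lemma reward_step {ε γ α : ℝ} (hε : 0 < ε) (hε1 : ε ≤ 1) (hγ : 0 < γ) (n : ℕ)
    (x : ℕ → Fin 3) :
    ∑ j, metropolis (biased ε (weights γ α x n)) (x n) j
      * reward (n + 1) (Function.update x (n + 1) j) ≤ reward n x := by
  by_cases hx : ∀ k ≤ n, x k ≠ 2
  · have hsum := metropolis_sum (biased ε (weights γ α x n)) (x n)
    have hd : reward n x = (3 / 2) ^ visits x n := if_pos hx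
    have hd' : ∀ j, reward (n + 1) (Function.update x (n + 1) j) =
        if j = 2 then 0 else (3 / 2) ^ visits x n * if x n = 1 then 3 / 2 else 1 := by
      intro j
      unfold reward
      rw [visits_update, visits_succ]
      by_cases hj : j = 2
      · rw [if_neg fun h => (forall_update_ne.1 h).2 hj, if_pos hj]
      · rw [if_pos (forall_update_ne.2 ⟨hx, hj⟩), if_neg hj, pow_add]
        split_ifs <;> simp
    have hv : (0 : ℝ) < (3 / 2) ^ visits x n := by positivity
    simp only [Fin.sum_univ_three, hd', hd] at hsum ⊢
    rcases fin_three_ne_two (hx n le_rfl) with h | h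
    · simp only [h, metropolis_zero_two] at hsum ⊢
      simp
      rw [← add_mul, ← sub_nonneg]
      nlinarith
    · have h1 := metropolis_one_two (α := α) hε hε1 hγ hx
      simp only [h] at hsum ⊢
      simp
      rw [h1] at hsum
      rw [← add_mul]
      have : metropolis (biased ε (weights γ α x n)) 1 0 +
        metropolis (biased ε (weights γ α x n)) 1 1 = 2 / 3 := by linarith
      rw [this]
      linarith
  · have hd' : ∀ j, reward (n + 1) (Function.update x (n + 1) j) = 0 :=
      fun j => if_neg fun h => hx (forall_update_ne.1 h).1
    simp only [hd', mul_zero, Finset.sum_const_zero]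
    exact reward_nonneg n x

lemma lintegral_reward_le_one {ε γ : ℝ} (α : ℝ) (hε : 0 < ε) (hε1 : ε ≤ 1) (hγ : 0 < γ) (n : ℕ) :
    ∫⁻ x, ENNReal.ofReal (reward n x) ∂law ε γ α ≤ 1 := by
  induction n with
  | zero =>
    refine (lintegral_mono (g := fun _ => 1) fun x => ?_).trans (by simp)
    rw [ENNReal.ofReal_le_one]
    unfold reward
    split_ifs <;> simp [visits]
  | succ n ih =>
    exact (lintegral_law_le_of_step (dependsOn_reward _) (dependsOn_reward _) (reward_nonneg _)
      (reward_step hε hε1 hγ n)).trans ih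

lemma lintegral_discount_le {ε γ α : ℝ} (hε : 0 < ε) (hε1 : ε ≤ 1) (hγ : 0 < γ) (hα : 0 ≤ α)
    (K m l : ℕ) :
    ∫⁻ x, ENNReal.ofReal (discount K (m + l) x) ∂law ε γ α ≤ ENNReal.ofReal
      ((1 - 1 / 6 * min 1 (ε * growth γ α m / ((1 + γ) ^ K) ^ 2)) ^ l) := by
  have hq : 0 ≤ 1 - 1 / 6 * min 1 (ε * growth γ α m / ((1 + γ) ^ K) ^ 2) := by
    have := min_le_left 1 (ε * growth γ α m / ((1 + γ) ^ K) ^ 2)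
    linarith
  induction l with
  | zero =>
    refine (lintegral_mono (g := fun _ => 1) fun x => ?_).trans (by simp)
    exact ENNReal.ofReal_le_one.2 (discount_le_one K _ x)
  | succ l ih =>
    refine (lintegral_law_le_of_step (dependsOn_discount K (m + l + 1))
      (fun x y h => by simp only [dependsOn_discount K (m + l) h]) (discount_nonneg K _)
      (discount_step hε hε1 hγ hα (Nat.le_add_right m l))).trans ?_
    simp_rw [ENNReal.ofReal_mul hq]
    rw [lintegral_const_mul _ (measurable_of_dependsOn (dependsOn_discount K _)).ennreal_ofReal,
      pow_succ' _ l, ENNReal.ofReal_mul hq]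
    gcongr

-- Without exit, either there are at most `K` visits, and `2 ^ K * discount ≥ 1`, or there are more,
-- and `(2/3) ^ K * reward ≥ 1`.
open Classical in
lemma law_stay_le {ε γ α : ℝ} (hε : 0 < ε) (hε1 : ε ≤ 1) (hγ : 0 < γ) (hα : 0 ≤ α)
    (K m l : ℕ) :
    ∫⁻ x, ENNReal.ofReal (if ∀ k ≤ m + l, x k ≠ 2 then 1 else 0) ∂law ε γ α ≤ ENNReal.ofReal
      (2 ^ K * (1 - 1 / 6 * min 1 (ε * growth γ α m / ((1 + γ) ^ K) ^ 2)) ^ l + (2 / 3) ^ K) := by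
  have hpt : ∀ x : ℕ → Fin 3, (if ∀ k ≤ m + l, x k ≠ 2 then (1 : ℝ) else 0) ≤
      2 ^ K * discount K (m + l) x + (2 / 3) ^ K * reward (m + l) x := by
    intro x
    have h1 := discount_nonneg K (m + l) x
    have h2 := reward_nonneg (m + l) x
    split_ifs with hx
    · by_cases hK : visits x (m + l + 1) ≤ K
      · have h3 : discount K (m + l) x = (1 / 2) ^ visits x (m + l + 1) := if_pos ⟨hx, hK⟩
        have h4 : (1 / 2 : ℝ) ^ K ≤ discount K (m + l) x := by
          rw [h3]; exact pow_le_pow_of_le_one (by norm_num) (by norm_num) hK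
        have h5 : (2 : ℝ) ^ K * (1 / 2) ^ K = 1 := by rw [← mul_pow]; norm_num
        have h6 : (2 : ℝ) ^ K * (1 / 2) ^ K ≤ 2 ^ K * discount K (m + l) x := by gcongr
        have h7 : 0 ≤ (2 / 3 : ℝ) ^ K * reward (m + l) x := by positivity
        linarith
      · have h3 : reward (m + l) x = (3 / 2) ^ visits x (m + l) := if_pos hx
        -- `discount` counts the final time and `reward` does not; the strict inequality `K < visits
        -- x (m + l + 1)` absorbs this difference of at most one.
        have h0 : K ≤ visits x (m + l) := by
          rw [visits_succ] at hK
          split_ifs at hK <;> lia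
        have h4 : (3 / 2 : ℝ) ^ K ≤ reward (m + l) x := by
          rw [h3]; exact pow_le_pow_right₀ (by norm_num) h0
        have h5 : (2 / 3 : ℝ) ^ K * (3 / 2) ^ K = 1 := by rw [← mul_pow]; norm_num
        have h6 : (2 / 3 : ℝ) ^ K * (3 / 2) ^ K ≤ (2 / 3) ^ K * reward (m + l) x := by gcongr
        have h7 : 0 ≤ (2 : ℝ) ^ K * discount K (m + l) x := by positivity
        linarith
    · positivity
  have hq : 0 ≤ 1 - 1 / 6 * min 1 (ε * growth γ α m / ((1 + γ) ^ K) ^ 2) := by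
    have := min_le_left 1 (ε * growth γ α m / ((1 + γ) ^ K) ^ 2)
    linarith
  refine (lintegral_mono fun x => ENNReal.ofReal_le_ofReal (hpt x)).trans ?_
  have hadd : ∀ x : ℕ → Fin 3, ENNReal.ofReal
      (2 ^ K * discount K (m + l) x + (2 / 3) ^ K * reward (m + l) x) =
      ENNReal.ofReal (2 ^ K) * ENNReal.ofReal (discount K (m + l) x) +
        ENNReal.ofReal ((2 / 3) ^ K) * ENNReal.ofReal (reward (m + l) x) := by
    intro x
    have h1 := discount_nonneg K (m + l) x
    have h2 := reward_nonneg (m + l) x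
    rw [ENNReal.ofReal_add (by positivity) (by positivity), ENNReal.ofReal_mul (by positivity),
      ENNReal.ofReal_mul (by positivity)]
  simp_rw [hadd]
  have hmd := (measurable_of_dependsOn (dependsOn_discount K (m + l))).ennreal_ofReal
  have hmr := (measurable_of_dependsOn (dependsOn_reward (m + l))).ennreal_ofReal
  rw [lintegral_add_left (hmd.const_mul _), lintegral_const_mul _ hmd, lintegral_const_mul _ hmr,
    ENNReal.ofReal_add (by positivity) (by positivity), ENNReal.ofReal_mul (by positivity)]
  gcongr
  · exact lintegral_discount_le hε hε1 hγ hα K m l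
  · exact mul_le_of_le_one_right' (lintegral_reward_le_one α hε hε1 hγ _)

/-! ### From the two estimates to the exit probability. -/

lemma exitTime_eq_iff {x : ℕ → Fin 3} {n : ℕ} :
    exitTime x = n ↔ x n = 2 ∧ ∀ k < n, x k ≠ 2 := by
  classical
  have hle : ∀ k, x k = 2 → exitTime x ≤ k := fun k hk => iInf₂_le k hk
  constructor
  · intro h
    have hlt : ∀ k < n, x k ≠ 2 := fun k hk hx => by
      have := hle k hx
      rw [h, Nat.cast_le] at this
      lia
    refine ⟨by_contra fun hn => ?_, hlt⟩
    have : ((n + 1 : ℕ) : ℕ∞) ≤ exitTime x := by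
      refine le_iInf₂ fun k hk => Nat.cast_le.2 ?_
      by_contra! hkn
      rcases Nat.lt_or_ge k n with h' | h'
      · exact hlt k h' hk
      · exact hn (by rwa [show n = k by lia])
    rw [h, Nat.cast_le] at this
    lia
  · rintro ⟨h, hlt⟩
    refine le_antisymm (hle n h) (le_iInf₂ fun k hk => Nat.cast_le.2 ?_)
    by_contra! hkn
    exact hlt k hkn hk

lemma exitProb_le_one (ε γ α a b : ℝ) : exitProb ε γ α a b ≤ 1 := measureReal_le_one

/-- The quantitative form of the theorem. -/
lemma one_sub_exitProb_le {ε γ α a b : ℝ} (hε : 0 < ε) (hε1 : ε ≤ 1) (hγ : 0 < γ) (hα : 0 ≤ α)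
    (K m l : ℕ) (hb : ((m + l : ℕ) : ℝ) < b) :
    1 - exitProb ε γ α a b ≤ ε * ((⌊a⌋₊ : ℝ) ^ α * growth γ α ⌊a⌋₊ / γ) +
      (2 ^ K * (1 - 1 / 6 * min 1 (ε * growth γ α m / ((1 + γ) ^ K) ^ 2)) ^ l + (2 / 3) ^ K) := by
  classical
  set A := {x | ∃ n : ℕ, exitTime x = n ∧ a < n ∧ n < b} with hA
  have hq : 0 ≤ 1 - 1 / 6 * min 1 (ε * growth γ α m / ((1 + γ) ^ K) ^ 2) := by
    have := min_le_left 1 (ε * growth γ α m / ((1 + γ) ^ K) ^ 2)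
    linarith
  have hg := one_le_growth hγ α ⌊a⌋₊
  -- Every trajectory is in `A`, or has left `0` by time `⌊a⌋₊`, or has not exited by time `m + l <
  -- b`.
  have hpt : ∀ x : ℕ → Fin 3, (1 : ENNReal) ≤ A.indicator 1 x +
      (ENNReal.ofReal (if ∀ k ≤ ⌊a⌋₊, x k = 0 then 0 else 1) +
        ENNReal.ofReal (if ∀ k ≤ m + l, x k ≠ 2 then 1 else 0)) := by
    intro x
    by_cases h1 : ∀ k ≤ ⌊a⌋₊, x k = 0
    · by_cases h2 : ∀ k ≤ m + l, x k ≠ 2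
      · rw [if_pos h2, ENNReal.ofReal_one]
        exact le_add_left (le_add_left le_rfl)
      · have hx : x ∈ A := by
          push Not at h2
          obtain ⟨k, hk, hk2⟩ := h2
          have hex : ∃ k, x k = 2 := ⟨k, hk2⟩
          refine ⟨Nat.find hex, exitTime_eq_iff.2 ⟨Nat.find_spec hex, fun j => Nat.find_min hex⟩,
            ?_, lt_of_le_of_lt (Nat.cast_le.2 ((Nat.find_min' hex hk2).trans hk)) hb⟩
          by_contra! hle
          have h3 := h1 _ (Nat.le_floor hle)
          rw [Nat.find_spec hex] at h3
          exact absurd h3 (by decide)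
        simp [hx]
    · rw [if_neg h1]
      simp [add_left_comm]
  have hmeas : ∀ n : ℕ, Measurable fun x : ℕ → Fin 3 =>
      ENNReal.ofReal (if ∀ k ≤ n, x k ≠ 2 then 1 else 0) := fun n =>
    measurable_of_dependsOn (n := n) fun x y h => by simp only [forall_le_congr h]
  have hAm : MeasurableSet A := by
    have : A = ⋃ n : ℕ, {x | exitTime x = n ∧ a < n ∧ n < b} := by
      ext x; simp [hA]
    rw [this]
    refine MeasurableSet.iUnion fun n => ?_
    refine measurableSet_setOfPred.2 (measurable_of_dependsOn (n := n) fun x y h => ?_)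
    simp only [exitTime_eq_iff, h n (le_refl n)]
    congr 2
    exact propext (forall₂_congr fun k hk => by rw [h k (le_of_lt hk)])
  have h1 : (1 : ENNReal) ≤ law ε γ α A +
      (ENNReal.ofReal (ε * ∑ k ∈ Finset.range ⌊a⌋₊, growth γ α k) + ENNReal.ofReal
      (2 ^ K * (1 - 1 / 6 * min 1 (ε * growth γ α m / ((1 + γ) ^ K) ^ 2)) ^ l + (2 / 3) ^ K)) := by
    have := lintegral_mono (μ := law ε γ α) hpt
    rw [lintegral_const, measure_univ, mul_one,
      lintegral_add_left (measurable_one.indicator hAm), lintegral_indicator_one hAm,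
      lintegral_add_right _ (hmeas _)] at this
    refine this.trans ?_
    gcongr
    · exact law_leave_le hε hγ _
    · exact law_stay_le hε hε1 hγ hα K m l
  have hs : 0 ≤ ε * ∑ k ∈ Finset.range ⌊a⌋₊, growth γ α k :=
    mul_nonneg hε.le (Finset.sum_nonneg fun k _ => zero_le_one.trans (one_le_growth hγ α k))
  rw [← ofReal_measureReal, ← ENNReal.ofReal_add hs (by positivity),
    ← ENNReal.ofReal_add measureReal_nonneg (by positivity), ENNReal.one_le_ofReal] at h1
  have h2 := mul_le_mul_of_nonneg_left (growth_sum_le hγ hα ⌊a⌋₊) hε.le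
  change 1 - (law ε γ α).real A ≤ _
  linarith

/-! ### Growth of the weight of a stratum that is never left -/

/-- This is `log (1 + y) ≥ 1 - 1/(1 + y)`; it turns products `∏ (1 + y)` into lower bounds by
exponentials of sums. -/
lemma exp_div_one_add_le {y : ℝ} (hy : 0 ≤ y) : Real.exp (y / (1 + y)) ≤ 1 + y := by
  have hy' : 0 < 1 + y := by linarith
  rw [← Real.le_log_iff_exp_le hy']
  refine le_trans (le_of_eq ?_) (Real.one_sub_inv_le_log_of_pos hy')
  field_simp
  ring

/-- Combine `1 + y ≤ exp y` with the comparison of `∑ k^(-α)` and `n^(1-α)/(1-α)`, done stepwise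
through Bernoulli's inequality. -/
lemma growth_le_exp {γ α : ℝ} (hγ : 0 < γ) (hα : 0 ≤ α) (hα1 : α < 1) (n : ℕ) :
    growth γ α n ≤ Real.exp (γ / (1 - α) * (n : ℝ) ^ (1 - α)) := by
  have h1 : 0 < 1 - α := by linarith
  induction n with
  | zero => rw [growth_zero]; exact Real.one_le_exp (by positivity)
  | succ n ih =>
    have hn : (0 : ℝ) < (n : ℝ) + 1 := by positivity
    have hb : (n : ℝ) ^ (1 - α) ≤ ((n : ℝ) + 1) ^ (1 - α) - (1 - α) * ((n : ℝ) + 1) ^ (-α) := by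
      have h2 := rpow_one_add_le_one_add_mul_self (s := -1 / ((n : ℝ) + 1))
        (by rw [le_div_iff₀ hn]; linarith [(Nat.cast_nonneg n : (0 : ℝ) ≤ n)]) h1.le
        (by linarith : 1 - α ≤ 1)
      have h3 : (n : ℝ) = ((n : ℝ) + 1) * (1 + -1 / ((n : ℝ) + 1)) := by field_simp; ring
      have h4 : (0 : ℝ) ≤ 1 + -1 / ((n : ℝ) + 1) := by
        have : 1 + -1 / ((n : ℝ) + 1) = n / (n + 1) := by field_simp; ring
        rw [this]; positivity
      have h5 : ((n : ℝ) + 1) ^ (-α) = ((n : ℝ) + 1) ^ (1 - α) / ((n : ℝ) + 1) := by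
        rw [← Real.rpow_sub_one hn.ne']; congr 1; ring
      calc (n : ℝ) ^ (1 - α)
          = ((n : ℝ) + 1) ^ (1 - α) * (1 + -1 / ((n : ℝ) + 1)) ^ (1 - α) := by
            rw [← Real.mul_rpow hn.le h4, ← h3]
        _ ≤ ((n : ℝ) + 1) ^ (1 - α) * (1 + (1 - α) * (-1 / ((n : ℝ) + 1))) := by gcongr
        _ = _ := by rw [h5]; ring
    rw [growth_succ]
    have hs : 1 + stepSize γ α (n + 1) ≤ Real.exp (γ * ((n : ℝ) + 1) ^ (-α)) := by
      have := Real.add_one_le_exp (γ * ((n : ℝ) + 1) ^ (-α))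
      simp only [stepSize]
      push_cast
      linarith
    calc growth γ α n * (1 + stepSize γ α (n + 1))
        ≤ Real.exp (γ / (1 - α) * (n : ℝ) ^ (1 - α)) * Real.exp (γ * ((n : ℝ) + 1) ^ (-α)) := by
          have := stepSize_nonneg hγ α (n + 1)
          gcongr
      _ ≤ _ := by
          rw [← Real.exp_add]
          refine Real.exp_le_exp.2 ?_
          push_cast
          have h6 : γ / (1 - α) * (n : ℝ) ^ (1 - α) ≤
            γ / (1 - α) * (((n : ℝ) + 1) ^ (1 - α) - (1 - α) * ((n : ℝ) + 1) ^ (-α)) := by gcongr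
          have h7 : γ / (1 - α) * (((n : ℝ) + 1) ^ (1 - α) - (1 - α) * ((n : ℝ) + 1) ^ (-α)) =
            γ / (1 - α) * ((n : ℝ) + 1) ^ (1 - α) - γ * ((n : ℝ) + 1) ^ (-α) := by
            field_simp
          linarith

/-- The factor `r < 1` pays for the second-order loss in `log (1 + y)` and for the shift from `n` to
`n + 1`; the constant `c` pays for the initial terms. -/
lemma exists_exp_le_growth {γ α r : ℝ} (hγ : 0 < γ) (hα : 0 < α) (hα1 : α < 1) (hr : 0 < r)
    (hr1 : r < 1) : ∃ c : ℝ, 0 < c ∧ ∀ᶠ n : ℕ in atTop,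
      c * Real.exp (r * (γ / (1 - α) * (n : ℝ) ^ (1 - α))) ≤ growth γ α n := by
  have h1 : 0 < 1 - α := by linarith
  have hlim : Tendsto (fun n : ℕ => (1 - r) * (n : ℝ) ^ α) atTop atTop :=
    ((tendsto_rpow_atTop hα).comp tendsto_natCast_atTop_atTop).const_mul_atTop (by linarith)
  -- Beyond `N`, subadditivity of `t ↦ t^α` gives `r * ((n+1)^α + γ) ≤ n^α`, which is what the
  -- induction step needs.
  obtain ⟨N, hN⟩ := eventually_atTop.1
    ((hlim.eventually_ge_atTop (r * (1 + γ))).and (eventually_ge_atTop 1))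
  refine ⟨Real.exp (-(r * (γ / (1 - α) * (N : ℝ) ^ (1 - α)))), Real.exp_pos _,
    eventually_atTop.2 ⟨N, fun n hn => ?_⟩⟩
  induction n, hn using Nat.le_induction with
  | base => rw [← Real.exp_add, neg_add_cancel, Real.exp_zero]; exact one_le_growth hγ α N
  | succ n hn ih =>
    obtain ⟨hbig, hn1⟩ := hN n hn
    have hn0 : (0 : ℝ) < n := by exact_mod_cast hn1
    have hsub : ((n : ℝ) + 1) ^ α ≤ (n : ℝ) ^ α + 1 := by
      simpa using Real.rpow_add_le_add_rpow hn0.le zero_le_one hα.le hα1.le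
    have hinc : ((n : ℝ) + 1) ^ (1 - α) ≤ (n : ℝ) ^ (1 - α) + (1 - α) / (n : ℝ) ^ α := by
      have h2 := rpow_one_add_le_one_add_mul_self (s := 1 / (n : ℝ))
        (by have : 0 ≤ 1 / (n : ℝ) := by positivity
            linarith) h1.le (by linarith : 1 - α ≤ 1)
      have h3 : (n : ℝ) + 1 = n * (1 + 1 / (n : ℝ)) := by field_simp
      have h5 : 1 / (n : ℝ) ^ α = (n : ℝ) ^ (1 - α) / n := by
        rw [← Real.rpow_sub_one hn0.ne', one_div, ← Real.rpow_neg hn0.le]; congr 1; ring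
      calc ((n : ℝ) + 1) ^ (1 - α)
          = (n : ℝ) ^ (1 - α) * (1 + 1 / (n : ℝ)) ^ (1 - α) := by
            rw [h3, Real.mul_rpow hn0.le (by positivity)]
        _ ≤ (n : ℝ) ^ (1 - α) * (1 + (1 - α) * (1 / (n : ℝ))) := by gcongr
        _ = (n : ℝ) ^ (1 - α) + (1 - α) * ((n : ℝ) ^ (1 - α) / n) := by ring
        _ = _ := by rw [← h5]; ring
    have hp : (0 : ℝ) < (n : ℝ) ^ α := by positivity
    have hp' : (0 : ℝ) < ((n : ℝ) + 1) ^ α := by positivity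
    have hs : stepSize γ α (n + 1) = γ / ((n : ℝ) + 1) ^ α := by
      rw [stepSize, Real.rpow_neg (by positivity)]; push_cast; rfl
    have hstep : Real.exp (r * (γ / (n : ℝ) ^ α)) ≤ 1 + stepSize γ α (n + 1) := by
      refine le_trans (Real.exp_le_exp.2 ?_) (exp_div_one_add_le (stepSize_nonneg hγ α (n + 1)))
      have h8 : stepSize γ α (n + 1) / (1 + stepSize γ α (n + 1)) =
          γ / (((n : ℝ) + 1) ^ α + γ) := by rw [hs]; field_simp
      rw [h8, ← mul_div_assoc, div_le_div_iff₀ hp (by positivity)]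
      have : r * (((n : ℝ) + 1) ^ α + γ) ≤ (n : ℝ) ^ α := by nlinarith
      nlinarith
    rw [growth_succ]
    refine le_trans ?_ (mul_le_mul ih hstep (Real.exp_pos _).le
      (zero_le_one.trans (one_le_growth hγ α n)))
    rw [mul_assoc, ← Real.exp_add (r * _)]
    gcongr
    push_cast
    have h9 : γ / (1 - α) * ((n : ℝ) + 1) ^ (1 - α) ≤
        γ / (1 - α) * ((n : ℝ) ^ (1 - α) + (1 - α) / (n : ℝ) ^ α) := by gcongr
    have h10 : γ / (1 - α) * ((n : ℝ) ^ (1 - α) + (1 - α) / (n : ℝ) ^ α) =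
        γ / (1 - α) * (n : ℝ) ^ (1 - α) + γ / (n : ℝ) ^ α := by field_simp
    nlinarith

/-! ### Polynomial growth in the case `α = 1`. -/

lemma stepSize_one (γ : ℝ) (n : ℕ) : stepSize γ 1 (n + 1) = γ / ((n : ℝ) + 1) := by
  rw [stepSize, Real.rpow_neg_one]; push_cast; rfl

lemma growth_one_le {γ : ℝ} (hγ : 0 < γ) (n : ℕ) :
    growth γ 1 (n + 1) ≤ (1 + γ) * ((n : ℝ) + 1) ^ γ := by
  induction n with
  | zero => simp [growth_succ, growth_zero, stepSize]
  | succ n ih =>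
    have hn : (0 : ℝ) < (n : ℝ) + 1 := by positivity
    have h1 : 1 + stepSize γ 1 (n + 1 + 1) ≤ (((n : ℝ) + 2) / ((n : ℝ) + 1)) ^ γ := by
      rw [stepSize_one, Real.rpow_def_of_pos (by positivity)]
      have h2 := Real.one_sub_inv_le_log_of_pos
        (show 0 < ((n : ℝ) + 2) / ((n : ℝ) + 1) by positivity)
      have h3 : 1 - (((n : ℝ) + 2) / ((n : ℝ) + 1))⁻¹ = 1 / ((n : ℝ) + 2) := by field_simp; ring
      have h4 := Real.add_one_le_exp (Real.log (((n : ℝ) + 2) / ((n : ℝ) + 1)) * γ)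
      rw [h3] at h2
      have h5 := mul_le_mul_of_nonneg_right h2 hγ.le
      have h6 : γ / (((n + 1 : ℕ) : ℝ) + 1) = 1 / ((n : ℝ) + 2) * γ := by push_cast; ring
      linarith
    rw [growth_succ]
    calc growth γ 1 (n + 1) * (1 + stepSize γ 1 (n + 1 + 1))
        ≤ (1 + γ) * ((n : ℝ) + 1) ^ γ * (((n : ℝ) + 2) / ((n : ℝ) + 1)) ^ γ := by
          have := stepSize_nonneg hγ 1 (n + 1 + 1)
          gcongr
      _ = (1 + γ) * (((n + 1 : ℕ) : ℝ) + 1) ^ γ := by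
          rw [mul_assoc, ← Real.mul_rpow hn.le (by positivity)]
          congr 2
          push_cast
          field_simp
          ring

lemma mul_growth_one_le {γ : ℝ} (hγ : 0 < γ) (n : ℕ) :
    (n : ℝ) ^ (1 : ℝ) * growth γ 1 n ≤ (1 + γ) * (n : ℝ) ^ (1 + γ) := by
  rcases n with _ | n
  · simp only [Nat.cast_zero]
    rw [Real.zero_rpow one_ne_zero, Real.zero_rpow (by positivity)]
    simp
  · have h := growth_one_le hγ n
    have hn : (0 : ℝ) < (n : ℝ) + 1 := by positivity
    push_cast
    rw [Real.rpow_add hn]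
    have := mul_le_mul_of_nonneg_left h (show 0 ≤ ((n : ℝ) + 1) ^ (1 : ℝ) by positivity)
    linarith

lemma le_growth_one {γ : ℝ} (hγ : 0 < γ) (n : ℕ) : ((n : ℝ) / (1 + γ)) ^ γ ≤ growth γ 1 n := by
  -- The shift by `1 + γ` gives equality at `n = 0` and matches `y/(1+y) = γ/(n+1+γ)` for `y =
  -- γ/(n+1)`.
  have key : (((n : ℝ) + 1 + γ) / (1 + γ)) ^ γ ≤ growth γ 1 n := by
    induction n with
    | zero =>
      have : (((0 : ℕ) : ℝ) + 1 + γ) / (1 + γ) = 1 := by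
        rw [Nat.cast_zero, zero_add]; exact div_self (by positivity)
      rw [this, Real.one_rpow, growth_zero]
    | succ n ih =>
      have hn : (0 : ℝ) < (n : ℝ) + 1 + γ := by positivity
      have h1 : (1 + 1 / ((n : ℝ) + 1 + γ)) ^ γ ≤ 1 + stepSize γ 1 (n + 1) := by
        refine le_trans ?_ (exp_div_one_add_le (stepSize_nonneg hγ 1 (n + 1)))
        rw [Real.rpow_def_of_pos (by positivity), stepSize_one]
        refine Real.exp_le_exp.2 ?_
        have h2 := Real.log_le_sub_one_of_pos
          (show 0 < 1 + 1 / ((n : ℝ) + 1 + γ) by positivity)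
        have h3 : γ / ((n : ℝ) + 1) / (1 + γ / ((n : ℝ) + 1)) = 1 / ((n : ℝ) + 1 + γ) * γ := by
          field_simp
        rw [h3]
        gcongr
        linarith
      rw [growth_succ]
      refine le_trans (le_of_eq ?_) (mul_le_mul ih h1 (by positivity)
        (zero_le_one.trans (one_le_growth hγ 1 n)))
      rw [← Real.mul_rpow (by positivity) (by positivity)]
      congr 1
      push_cast
      field_simp
      ring
  refine le_trans ?_ key
  gcongr
  linarith

/-! ### The limit -/

/-- Reduces the theorem to deterministic asymptotics: `m` steps let the weight grow and `l` further
steps serve as trials. The arbitrary constant `c` stands for `(1 + γ)^(-2K)`. -/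
lemma tendsto_exitProb {γ α : ℝ} (hγ : 0 < γ) (hα : 0 ≤ α) {a b : ℝ → ℝ}
    (ha : Tendsto (fun ε => ε * ((⌊a ε⌋₊ : ℝ) ^ α * growth γ α ⌊a ε⌋₊ / γ)) (𝓝[>] 0) (𝓝 0))
    (hb : ∀ c : ℝ, 0 < c → ∃ m l : ℝ → ℕ, (∀ᶠ ε in 𝓝[>] 0, ((m ε + l ε : ℕ) : ℝ) < b ε) ∧
      Tendsto (fun ε => (l ε : ℝ) * min 1 (c * (ε * growth γ α (m ε)))) (𝓝[>] 0) atTop) :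
    Tendsto (fun ε => exitProb ε γ α (a ε) (b ε)) (𝓝[>] 0) (𝓝 1) := by
  refine tendsto_order.2 ⟨fun u hu => ?_, fun u hu =>
    Eventually.of_forall fun ε => (exitProb_le_one _ _ _ _ _).trans_lt hu⟩
  -- `K` is fixed before `ε`; each of the three error terms gets a third of `1 - u`.
  obtain ⟨K, hK⟩ := exists_pow_lt_of_lt_one (show 0 < (1 - u) / 3 by linarith)
    (show (2 / 3 : ℝ) < 1 by norm_num)
  have hKp : 0 < (((1 + γ) ^ K) ^ 2)⁻¹ := by positivity
  obtain ⟨m, l, hml, hl⟩ := hb _ hKp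
  have hexp : Tendsto (fun ε => 2 ^ K * Real.exp (-(1 / 6 *
      ((l ε : ℝ) * min 1 ((((1 + γ) ^ K) ^ 2)⁻¹ * (ε * growth γ α (m ε))))))) (𝓝[>] 0) (𝓝 0) := by
    simpa using ((Real.tendsto_exp_neg_atTop_nhds_zero.comp
      (hl.const_mul_atTop (show (0 : ℝ) < 1 / 6 by norm_num))).const_mul ((2 : ℝ) ^ K))
  filter_upwards [hml, ha.eventually_lt_const (show 0 < (1 - u) / 3 by linarith),
    hexp.eventually_lt_const (show 0 < (1 - u) / 3 by linarith),
    Ioo_mem_nhdsGT (show (0 : ℝ) < 1 by norm_num)] with ε h1 h2 h3 hε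
  have h4 := one_sub_exitProb_le (a := a ε) hε.1 hε.2.le hγ hα K (m ε) (l ε) h1
  have heq : (((1 + γ) ^ K) ^ 2)⁻¹ * (ε * growth γ α (m ε)) =
      ε * growth γ α (m ε) / ((1 + γ) ^ K) ^ 2 := by ring
  rw [heq] at h3
  set p := min 1 (ε * growth γ α (m ε) / ((1 + γ) ^ K) ^ 2) with hp
  have hp1 : p ≤ 1 := min_le_left _ _
  have h5 : (1 - 1 / 6 * p) ^ l ε ≤ Real.exp (-(1 / 6 * ((l ε : ℝ) * p))) := by
    have h6 : 1 - 1 / 6 * p ≤ Real.exp (-(1 / 6 * p)) := by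
      have := Real.add_one_le_exp (-(1 / 6 * p)); linarith
    calc (1 - 1 / 6 * p) ^ l ε ≤ Real.exp (-(1 / 6 * p)) ^ l ε :=
          pow_le_pow_left₀ (by linarith) h6 _
      _ = _ := by rw [← Real.exp_nat_mul]; congr 1; ring
  have h7 : (2 : ℝ) ^ K * (1 - 1 / 6 * p) ^ l ε ≤
      2 ^ K * Real.exp (-(1 / 6 * ((l ε : ℝ) * p))) := by gcongr
  linarith

lemma tendsto_abs_log_nhdsGT_zero : Tendsto (fun ε : ℝ => |Real.log ε|) (𝓝[>] 0) atTop :=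
  tendsto_abs_atBot_atTop.comp Real.tendsto_log_nhdsGT_zero

lemma tendsto_exitProb_of_lt_one {γ α : ℝ} (hγ : 0 < γ) (hα : 0 < α) (hα1 : α < 1)
    {Cb : ℝ} {β : ℝ → ℝ} (hCb : ((1 - α) / γ) ^ (1 / (1 - α)) < Cb)
    (hβ : ∀ ε ∈ Set.Ioo (0 : ℝ) 1, 0 ≤ β ε ∧ β ε ≤ |Real.log ε|)
    (hlim : Tendsto (fun ε : ℝ => |Real.log ε| ^ (α / (1 - α)) * Real.exp (-β ε))
      (𝓝[>] 0) (𝓝 0)) :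
    Tendsto (fun ε : ℝ => exitProb ε γ α
      (((1 - α) / γ * (|Real.log ε| - β ε)) ^ (1 / (1 - α)))
      (Cb * |Real.log ε| ^ (1 / (1 - α)))) (𝓝[>] 0) (𝓝 1) := by
  have h1 : 0 < 1 - α := by linarith
  have hlog : ∀ ε ∈ Set.Ioo (0 : ℝ) 1, ε * Real.exp |Real.log ε| = 1 := by
    intro ε hε
    rw [abs_of_neg (Real.log_neg hε.1 hε.2), Real.exp_neg, Real.exp_log hε.1]
    exact mul_inv_cancel₀ hε.1.ne'
  have hIoo : Set.Ioo (0 : ℝ) 1 ∈ 𝓝[>] (0 : ℝ) := Ioo_mem_nhdsGT (by norm_num)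
  refine tendsto_exitProb hγ hα.le ?_ fun c hc => ?_
  · have hlim' := hlim.const_mul (((1 - α) / γ) ^ (α / (1 - α)) / γ)
    rw [mul_zero] at hlim'
    refine squeeze_zero' ?_ ?_ hlim'
    · filter_upwards [hIoo] with ε hε
      have := one_le_growth hγ α
        ⌊((1 - α) / γ * (|Real.log ε| - β ε)) ^ (1 / (1 - α))⌋₊
      have := hε.1
      positivity
    · filter_upwards [hIoo] with ε hε
      obtain ⟨hβ0, hβ1⟩ := hβ ε hε
      have he := hlog ε hε
      set L := |Real.log ε| with hL
      have hz : 0 ≤ (1 - α) / γ * (L - β ε) := mul_nonneg (by positivity) (by linarith)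
      set n := ⌊((1 - α) / γ * (L - β ε)) ^ (1 / (1 - α))⌋₊ with hn
      have hna : (n : ℝ) ≤ ((1 - α) / γ * (L - β ε)) ^ (1 / (1 - α)) :=
        Nat.floor_le (by positivity)
      have h2 : (n : ℝ) ^ α ≤ ((1 - α) / γ) ^ (α / (1 - α)) * L ^ (α / (1 - α)) := by
        calc (n : ℝ) ^ α ≤ (((1 - α) / γ * (L - β ε)) ^ (1 / (1 - α))) ^ α := by gcongr
          _ = ((1 - α) / γ * (L - β ε)) ^ (α / (1 - α)) := by
            rw [← Real.rpow_mul hz]; congr 1; ring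
          _ ≤ ((1 - α) / γ * L) ^ (α / (1 - α)) := by
            gcongr
            linarith
          _ = _ := Real.mul_rpow (by positivity) (abs_nonneg _)
      -- The choice of `a(ε)` is exactly what makes the exponent `L - β ε`; multiplied by `ε = exp
      -- (-L)` this leaves `exp (-β ε)`.
      have h3 : growth γ α n ≤ Real.exp (L - β ε) := by
        refine (growth_le_exp hγ hα.le hα1 n).trans (Real.exp_le_exp.2 ?_)
        calc γ / (1 - α) * (n : ℝ) ^ (1 - α)
            ≤ γ / (1 - α) * (((1 - α) / γ * (L - β ε)) ^ (1 / (1 - α))) ^ (1 - α) := by gcongr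
          _ = γ / (1 - α) * ((1 - α) / γ * (L - β ε)) := by
            rw [← Real.rpow_mul hz, one_div_mul_cancel h1.ne', Real.rpow_one]
          _ = L - β ε := by field_simp
      have hg := one_le_growth hγ α n
      have hε0 := hε.1
      calc ε * ((n : ℝ) ^ α * growth γ α n / γ)
          ≤ ε * (((1 - α) / γ) ^ (α / (1 - α)) * L ^ (α / (1 - α)) *
            Real.exp (L - β ε) / γ) := by gcongr
        _ = (ε * Real.exp L) * (((1 - α) / γ) ^ (α / (1 - α)) / γ *
            (L ^ (α / (1 - α)) * Real.exp (-β ε))) := by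
            rw [sub_eq_add_neg L, Real.exp_add]; ring
        _ = _ := by rw [he, one_mul]
  -- The time window is split at `C |log ε|^(1/(1-α))`: up to there the exponent of `growth` reaches
  -- `κ |log ε|` with `κ > 1`, and `Cb - C` is left for trials.
  · obtain ⟨C, hC1, hC2⟩ := exists_between hCb
    have hC0 : 0 < C := lt_of_le_of_lt (by positivity) hC1
    have hκ : 1 < γ / (1 - α) * C ^ (1 - α) := by
      have h2 := Real.rpow_lt_rpow (by positivity) hC1 h1
      rw [← Real.rpow_mul (by positivity), one_div_mul_cancel h1.ne', Real.rpow_one] at h2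
      calc 1 = γ / (1 - α) * ((1 - α) / γ) := by field_simp
        _ < _ := by gcongr
    set κ := γ / (1 - α) * C ^ (1 - α) with hκd
    have hκ0 : 0 < κ := by linarith
    -- This `r` gives `r * κ = (κ + 1)/2 > 1`, so `ε * growth` still tends to infinity and the
    -- minimum is eventually `1`.
    obtain ⟨c₀, hc₀, hgrowth⟩ := exists_exp_le_growth (r := (κ + 1) / (2 * κ)) hγ hα hα1
      (by positivity) (by rw [div_lt_one (by positivity)]; linarith)
    have hpow : Tendsto (fun ε : ℝ => |Real.log ε| ^ (1 / (1 - α))) (𝓝[>] 0) atTop :=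
      (tendsto_rpow_atTop (by positivity)).comp tendsto_abs_log_nhdsGT_zero
    have hm : Tendsto (fun ε : ℝ => ⌈C * |Real.log ε| ^ (1 / (1 - α))⌉₊) (𝓝[>] 0) atTop :=
      tendsto_nat_ceil_atTop.comp (hpow.const_mul_atTop hC0)
    have hl : Tendsto (fun ε : ℝ => (Cb - C) * |Real.log ε| ^ (1 / (1 - α)) - 2)
        (𝓝[>] 0) atTop :=
      tendsto_atTop_add_const_right _ (-2) (hpow.const_mul_atTop (by linarith))
    -- Subtracting `2` compensates the ceiling and keeps the total strictly below `b(ε)`.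
    refine ⟨fun ε => ⌈C * |Real.log ε| ^ (1 / (1 - α))⌉₊,
      fun ε => ⌊(Cb - C) * |Real.log ε| ^ (1 / (1 - α)) - 2⌋₊, ?_, ?_⟩
    · filter_upwards [hl.eventually_ge_atTop 0] with ε hε
      have h2 := Nat.ceil_lt_add_one
        (show 0 ≤ C * |Real.log ε| ^ (1 / (1 - α)) by positivity)
      have h3 := Nat.floor_le hε
      push_cast
      linarith
    · refine ((tendsto_natCast_atTop_atTop (R := ℝ)).comp
        (tendsto_nat_floor_atTop.comp hl)).congr' ?_
      have hbig : Tendsto (fun ε : ℝ => c * c₀ * Real.exp ((κ - 1) / 2 * |Real.log ε|))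
          (𝓝[>] 0) atTop :=
        (Real.tendsto_exp_atTop.comp (tendsto_abs_log_nhdsGT_zero.const_mul_atTop
          (by linarith))).const_mul_atTop (by positivity)
      filter_upwards [hm.eventually hgrowth, hbig.eventually_ge_atTop 1, hIoo] with ε h2 h3 hε
      have he := hlog ε hε
      have hε0 := hε.1
      set L := |Real.log ε| with hL
      have hL0 : 0 ≤ L := abs_nonneg _
      have h4 : κ * L ≤ γ / (1 - α) * ((⌈C * L ^ (1 / (1 - α))⌉₊ : ℕ) : ℝ) ^ (1 - α) := by
        rw [hκd, mul_assoc]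
        gcongr
        calc C ^ (1 - α) * L = (C * L ^ (1 / (1 - α))) ^ (1 - α) := by
              rw [Real.mul_rpow hC0.le (by positivity), ← Real.rpow_mul hL0,
                one_div_mul_cancel h1.ne', Real.rpow_one]
          _ ≤ _ := by gcongr; exact Nat.le_ceil _
      have h5 : 1 ≤ c * (ε * growth γ α ⌈C * L ^ (1 / (1 - α))⌉₊) := by
        calc 1 ≤ c * c₀ * Real.exp ((κ - 1) / 2 * L) := h3
          _ = c * (ε * (c₀ * Real.exp ((κ + 1) / (2 * κ) * (κ * L)))) := by
            have : (κ + 1) / (2 * κ) * (κ * L) = L + (κ - 1) / 2 * L := by field_simp; ring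
            rw [this, Real.exp_add]
            linear_combination (-(c * c₀ * Real.exp ((κ - 1) / 2 * L))) * he
          _ ≤ c * (ε * (c₀ * Real.exp ((κ + 1) / (2 * κ) * (γ / (1 - α) *
              ((⌈C * L ^ (1 / (1 - α))⌉₊ : ℕ) : ℝ) ^ (1 - α))))) := by gcongr
          _ ≤ _ := by gcongr
      rw [min_eq_left h5, mul_one]
      rfl

/-- The scale `ε^(-1/(1+γ))` balances `ε * n * growth n`, of order `ε n^(1+γ)`: at `a(ε)` this is of
order `f^(1+γ)`, at `b(ε)` of order `g^(1+γ)`. -/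
lemma tendsto_exitProb_one {γ : ℝ} (hγ : 0 < γ) {f g : ℝ → ℝ}
    (hfg : ∀ ε ∈ Set.Ioo (0 : ℝ) 1, 0 < f ε ∧ 0 < g ε)
    (hf : Tendsto f (𝓝[>] 0) (𝓝 0)) (hg : Tendsto g (𝓝[>] 0) atTop) :
    Tendsto (fun ε : ℝ => exitProb ε γ 1 (ε ^ (-(1 / (1 + γ))) * f ε)
      (ε ^ (-(1 / (1 + γ))) * g ε)) (𝓝[>] 0) (𝓝 1) := by
  have h1 : 0 < 1 + γ := by linarith
  have hIoo : Set.Ioo (0 : ℝ) 1 ∈ 𝓝[>] (0 : ℝ) := Ioo_mem_nhdsGT (by norm_num)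
  have hscale : ∀ ε ∈ Set.Ioo (0 : ℝ) 1, ∀ y : ℝ, 0 ≤ y →
      ε * (ε ^ (-(1 / (1 + γ))) * y) ^ (1 + γ) = y ^ (1 + γ) := by
    intro ε hε y hy
    have hε0 := hε.1
    rw [Real.mul_rpow (by positivity) hy, ← Real.rpow_mul hε0.le, neg_mul,
      one_div_mul_cancel h1.ne', Real.rpow_neg_one, ← mul_assoc, mul_inv_cancel₀ hε0.ne', one_mul]
  refine tendsto_exitProb hγ zero_le_one ?_ fun c hc => ?_
  · have hlim : Tendsto (fun ε => (1 + γ) / γ * f ε ^ (1 + γ)) (𝓝[>] 0) (𝓝 0) := by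
      have h2 := (hf.rpow_const (p := 1 + γ) (Or.inr h1.le)).const_mul ((1 + γ) / γ)
      rwa [Real.zero_rpow h1.ne', mul_zero] at h2
    refine squeeze_zero' ?_ ?_ hlim
    · filter_upwards [hIoo] with ε hε
      have := one_le_growth hγ 1 ⌊ε ^ (-(1 / (1 + γ))) * f ε⌋₊
      have := hε.1
      positivity
    · filter_upwards [hIoo] with ε hε
      have hε0 := hε.1
      have hf0 := (hfg ε hε).1
      have h2 : (⌊ε ^ (-(1 / (1 + γ))) * f ε⌋₊ : ℝ) ≤ ε ^ (-(1 / (1 + γ))) * f ε :=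
        Nat.floor_le (by positivity)
      calc _ ≤ ε * ((1 + γ) * (⌊ε ^ (-(1 / (1 + γ))) * f ε⌋₊ : ℝ) ^ (1 + γ) / γ) := by
            gcongr ε * (?_ / γ)
            exact mul_growth_one_le hγ _
        _ ≤ ε * ((1 + γ) * (ε ^ (-(1 / (1 + γ))) * f ε) ^ (1 + γ) / γ) := by gcongr
        _ = (1 + γ) / γ * (ε * (ε ^ (-(1 / (1 + γ))) * f ε) ^ (1 + γ)) := by ring
        _ = _ := by rw [hscale ε hε _ hf0.le]
  · have hbg : ∀ ε ∈ Set.Ioo (0 : ℝ) 1, g ε ≤ ε ^ (-(1 / (1 + γ))) * g ε := by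
      intro ε hε
      refine le_mul_of_one_le_left (hfg ε hε).2.le ?_
      refine Real.one_le_rpow_of_pos_of_le_one_of_nonpos hε.1 hε.2.le ?_
      have : 0 < 1 / (1 + γ) := by positivity
      linarith
    -- Half of the time is for growth and half for trials, with `2` subtracted for rounding.
    refine ⟨fun ε => ⌈ε ^ (-(1 / (1 + γ))) * g ε / 2⌉₊,
      fun ε => ⌊ε ^ (-(1 / (1 + γ))) * g ε / 2 - 2⌋₊, ?_, ?_⟩
    · filter_upwards [hIoo, hg.eventually_ge_atTop 4] with ε hε hg4
      have h2 := hbg ε hε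
      have h3 := Nat.ceil_lt_add_one
        (show 0 ≤ ε ^ (-(1 / (1 + γ))) * g ε / 2 by linarith)
      have h4 := Nat.floor_le (show 0 ≤ ε ^ (-(1 / (1 + γ))) * g ε / 2 - 2 by linarith)
      push_cast
      linarith
    · set d := c / 4 * ((2 * (1 + γ)) ^ γ)⁻¹ with hd
      have hd0 : 0 < d := by positivity
      have hgp : Tendsto (fun ε => d * g ε ^ (1 + γ)) (𝓝[>] 0) atTop :=
        ((tendsto_rpow_atTop h1).comp hg).const_mul_atTop hd0
      refine tendsto_atTop.2 fun M => ?_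
      filter_upwards [hIoo, hg.eventually_ge_atTop 12, hg.eventually_ge_atTop (4 * M),
        hgp.eventually_ge_atTop M] with ε hε hg12 hgM hgpM
      have hε0 := hε.1
      have h2 := hbg ε hε
      have hsc := hscale ε hε (g ε) (by linarith)
      set b := ε ^ (-(1 / (1 + γ))) * g ε with hb
      have hb0 : 0 < b := by linarith
      -- Uses `b ≥ g ε ≥ 12`, so that `b/2 - 3 ≥ b/4`.
      have hl : b / 4 ≤ (⌊b / 2 - 2⌋₊ : ℝ) := by
        have := Nat.lt_floor_add_one (b / 2 - 2)
        linarith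
      have hgr : b ^ γ * ((2 * (1 + γ)) ^ γ)⁻¹ ≤ growth γ 1 ⌈b / 2⌉₊ := by
        refine le_trans ?_ (le_growth_one hγ _)
        rw [← Real.inv_rpow (by positivity), ← Real.mul_rpow hb0.le (by positivity)]
        gcongr
        calc b * (2 * (1 + γ))⁻¹ = b / 2 / (1 + γ) := by field_simp
          _ ≤ _ := by gcongr; exact Nat.le_ceil _
      refine le_trans ?_ (mul_le_mul_of_nonneg_right hl
        (le_min zero_le_one (by have := one_le_growth hγ 1 ⌈b / 2⌉₊; positivity)))
      rw [mul_min_of_nonneg _ _ (by positivity)]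
      refine le_min (by linarith) ?_
      calc M ≤ d * g ε ^ (1 + γ) := hgpM
        _ = b / 4 * (c * (ε * (b ^ γ * ((2 * (1 + γ)) ^ γ)⁻¹))) := by
          rw [← hsc, Real.rpow_add hb0, Real.rpow_one, hd]; ring
        _ ≤ _ := by gcongr

end WangLandau

theorem mainTheorem2 (γ α : ℝ) (hγ : 0 < γ) (hα : α ∈ Set.Icc (1 / 2 : ℝ) 1)
    (hαγ : α = 1 / 2 → γ < 1) :
    (α < 1 →
      ∀ (Cb : ℝ) (β : ℝ → ℝ),
        ((1 - α) / γ) ^ (1 / (1 - α)) < Cb →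
        (∀ ε ∈ Set.Ioo (0 : ℝ) 1, 0 ≤ β ε ∧ β ε ≤ |Real.log ε|) →
        Tendsto (fun ε : ℝ => |Real.log ε| ^ (α / (1 - α)) * Real.exp (-β ε)) (𝓝[>] 0) (𝓝 0) →
        Tendsto
          (fun ε : ℝ => WangLandau.exitProb ε γ α
            (((1 - α) / γ * (|Real.log ε| - β ε)) ^ (1 / (1 - α)))
            (Cb * |Real.log ε| ^ (1 / (1 - α))))
          (𝓝[>] 0) (𝓝 1)) ∧
    (α = 1 →
      ∀ f g : ℝ → ℝ,
        (∀ ε ∈ Set.Ioo (0 : ℝ) 1, 0 < f ε ∧ 0 < g ε) →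
        Tendsto f (𝓝[>] 0) (𝓝 0) →
        Tendsto g (𝓝[>] 0) atTop →
        Tendsto
          (fun ε : ℝ => WangLandau.exitProb ε γ α
            (ε ^ (-(1 / (1 + γ))) * f ε)
            (ε ^ (-(1 / (1 + γ))) * g ε))
          (𝓝[>] 0) (𝓝 1)) := by
  refine ⟨fun hα1 Cb β hCb hβ hlim => ?_, ?_⟩
  · exact WangLandau.tendsto_exitProb_of_lt_one hγ (by linarith [hα.1]) hα1 hCb hβ hlim
  · rintro rfl f g hfg hf hg
    exact WangLandau.tendsto_exitProb_one hγ hfg hf hg
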